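/- For $n\ge 1$ let $C_{n,k}$ (second-order Eulerian numbers) be the number of Stirling permutations of order $n$ with $k$ descents. Here a Stirling permutation of order $n$ is an arrangement $a_1\cdots a_{2n}$ of the multiset $\{1,1,2,2,\dots,n,n\}$ in which, for each $m$, all elements between the two occurrences of $m$ are greater than $m$; and a descent is an index $i$ with $1\le i<2n$ and $a_i>a_{i+1}$, or $i=2n$ (so $C_{1,1}=1$, $C_{1,0}=0$). Let $s(n,k)$ be the (signed) Stirling numbers of the first kind, let $B_n$ be the Bernoulli numbers, $\sum_{n\ge0}B_n\frac{x^n}{n!}=\frac{x}{e^x-1}$, and let $c^{(2)}_n$ be the Cauchy numbers of the second kind, $\sum_{n\ge0}c^{(2)}_n\frac{x^n}{n!}=\frac{-x}{(1-x)\ln(1-x)}$. For all integers $n\ge N\ge 1$, $$\sum_{k=1}^n(-1)^k\binom{2n-1}{N+k-1}^{-1}C_{n,k}=2n\sum_{k=0}^{N-1}(-1)^{N-1-k}s(N,N-k)\frac{B_{n-k}}{n-k}.$$ In particular (the case $N=n$), for all integers $n\ge 1$, $$2c^{(2)}_n=\sum_{k=1}^n(-1)^{n-k}\binom{2n-1}{n+k-1}^{-1}C_{n,k}.$$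 -/

import Mathlib

/-- A list `l` is a Stirling permutation of order `n` if it is an arrangement of the multiset
`{1, 1, 2, 2, …, n, n}` such that every entry `x` lying between two occurrences of an entry `m`
(that is, with `m, x, m` appearing in this order in `l`) is greater than `m`. -/
def IsStirlingPerm (n : ℕ) (l : List ℕ) : Prop :=
  (l : Multiset ℕ) = 2 • (Finset.Icc 1 n).val ∧
    ∀ m x : ℕ, List.Sublist [m, x, m] l → m < x

/-- The number of descents of a word. The last position of a nonempty word always counts as a
descent; this is the convention under which the unique Stirling permutation `1, 1` of order `1`
has one descent. -/
def descentCount : List ℕ → ℕ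
  | [] => 0
  | [_] => 1
  | a :: b :: l => (if b < a then 1 else 0) + descentCount (b :: l)

/-- The second-order Eulerian number `C_{n,k}`: the number of Stirling permutations of order `n`
with `k` descents. -/
noncomputable def secondOrderEulerian (n k : ℕ) : ℕ :=
  Set.ncard {l : List ℕ | IsStirlingPerm n l ∧ descentCount l = k}

/-- The (signed) Stirling number of the first kind `s(n,k)`, i.e. `(-1) ^ (n - k)` times
the number of permutations of `n` elements with `k` cycles. -/
def stirlingFirstSigned (n k : ℕ) : ℤ :=
  (-1) ^ (n + k) * (Nat.stirlingFirst n k : ℤ)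

/-- The Cauchy number of the second kind `c⁽²⁾_n`: `n!` times the coefficient of `x ^ n` in
`-x / ((1 - x) * log (1 - x))`, the quotient being taken in the field of formal Laurent series. -/
noncomputable def cauchySecond (n : ℕ) : ℚ :=
  (Nat.factorial n : ℚ) *
    HahnSeries.coeff
      (((-PowerSeries.X : PowerSeries ℚ) : LaurentSeries ℚ) /
        (((1 - PowerSeries.X) * PowerSeries.logOf (1 - PowerSeries.X) : PowerSeries ℚ) :
          LaurentSeries ℚ))
      (n : ℤ)

/-- Insert two adjacent copies of `m` into the word `l` after its first `i` entries. -/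
def insertPair (m i : ℕ) (l : List ℕ) : List ℕ :=
  l.take i ++ m :: m :: l.drop i

lemma insertPair_succ_cons (m i a : ℕ) (l : List ℕ) :
    insertPair m (i + 1) (a :: l) = a :: insertPair m i l := by
  simp [insertPair]

lemma filter_insertPair {m : ℕ} {l : List ℕ} (hm : m ∉ l) (i : ℕ) :
    (insertPair m i l).filter (· ≠ m) = l := by
  have h : ∀ l' : List ℕ, m ∉ l' → l'.filter (· ≠ m) = l' := fun l' h' =>
    List.filter_eq_self.2 fun a ha => by
      simp only [ne_eq, decide_not, Bool.not_eq_eq_eq_not, Bool.not_true, decide_eq_false_iff_not]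
      rintro rfl
      exact h' ha
  rw [insertPair, List.filter_append, List.filter_cons_of_neg (by simp),
    List.filter_cons_of_neg (by simp), h _ fun hi => hm (List.mem_of_mem_take hi),
    h _ fun hi => hm (List.mem_of_mem_drop hi), List.take_append_drop]

lemma idxOf_insertPair {m : ℕ} {l : List ℕ} (hm : m ∉ l) {i : ℕ} (hi : i ≤ l.length) :
    (insertPair m i l).idxOf m = i := by
  rw [insertPair, List.idxOf_append_of_notMem fun h => hm (List.mem_of_mem_take h)]
  simp [hi]

lemma coe_insertPair (m i : ℕ) (l : List ℕ) :
    (insertPair m i l : Multiset ℕ) = m ::ₘ m ::ₘ (l : Multiset ℕ) := by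
  rw [Multiset.cons_coe, Multiset.cons_coe, Multiset.coe_eq_coe, insertPair]
  refine List.perm_middle.trans (List.Perm.cons _ (List.perm_middle.trans (List.Perm.cons _ ?_)))
  rw [List.take_append_drop]

/-- The finite set of all Stirling permutations of order `n`, built by inserting the pairs
`m, m` for `m = 1, …, n` successively. -/
def stirlingPerms : ℕ → Finset (List ℕ)
  | 0 => {[]}
  | n + 1 => (stirlingPerms n ×ˢ Finset.range (2 * n + 1)).image
      fun p => insertPair (n + 1) p.2 p.1

lemma two_nsmul_Icc_succ_val (n : ℕ) :
    2 • (Finset.Icc 1 (n + 1)).val = (n + 1) ::ₘ (n + 1) ::ₘ (2 • (Finset.Icc 1 n).val) := by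
  have h : Finset.Icc 1 (n + 1) = Finset.cons (n + 1) (Finset.Icc 1 n) (by simp) := by
    ext x
    simp only [Finset.mem_Icc, Finset.mem_cons]
    omega
  rw [h, Finset.cons_val, two_nsmul, two_nsmul, Multiset.cons_add, Multiset.add_cons]

lemma IsStirlingPerm.le {n : ℕ} {l : List ℕ} (h : IsStirlingPerm n l) {x : ℕ} (hx : x ∈ l) :
    x ≤ n := by
  have : x ∈ (l : Multiset ℕ) := hx
  rw [h.1, Multiset.mem_nsmul] at this
  exact (Finset.mem_Icc.1 this.2).2

lemma IsStirlingPerm.length {n : ℕ} {l : List ℕ} (h : IsStirlingPerm n l) :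
    l.length = 2 * n := by
  have := congrArg Multiset.card h.1
  simpa using this

lemma IsStirlingPerm.insertPair {n : ℕ} {l : List ℕ} (h : IsStirlingPerm n l) (i : ℕ) :
    IsStirlingPerm (n + 1) (insertPair (n + 1) i l) := by
  have hn : n + 1 ∉ l := fun hl => by have := h.le hl; omega
  refine ⟨by rw [coe_insertPair, h.1, two_nsmul_Icc_succ_val], fun m x hs => ?_⟩
  have hmem : ∀ y ∈ [m, x, m], y = n + 1 ∨ y ∈ l := fun y hy => by
    have : y ∈ (_root_.insertPair (n + 1) i l : Multiset ℕ) := hs.subset hy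
    rw [coe_insertPair] at this
    simp only [Multiset.mem_cons, Multiset.mem_coe] at this
    tauto
  have hf := hs.filter (· ≠ n + 1)
  rw [filter_insertPair hn] at hf
  by_cases hm : m = n + 1
  · subst hm
    have hc := hs.count_le (n + 1)
    have hc' : (_root_.insertPair (n + 1) i l).count (n + 1) = 2 := by
      rw [← Multiset.coe_count, coe_insertPair]
      simp [List.count_eq_zero_of_not_mem hn]
    by_cases hx : x = n + 1
    · subst hx
      rw [hc'] at hc
      simp at hc
    · rw [_root_.insertPair] at hs
      have h1 : [n + 1, x, n + 1].Sublist ((n + 1) :: (n + 1) :: l.drop i) := by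
        obtain ⟨l₁, l₂, h12, hl1, hl2⟩ := List.sublist_append_iff.1 hs
        rcases l₁ with _ | ⟨a, l₁⟩
        · rw [List.nil_append] at h12
          exact h12 ▸ hl2
        · rw [List.cons_append, List.cons.injEq] at h12
          exact absurd (List.mem_of_mem_take (hl1.subset (h12.1 ▸ List.mem_cons_self))) hn
      rw [List.cons_sublist_cons] at h1
      rcases List.sublist_cons_iff.1 h1 with h2 | ⟨r, h2, -⟩
      · exact absurd (List.mem_of_mem_drop (h2.subset (by simp))) hn
      · exact absurd (List.cons.inj h2).1 hx
  · by_cases hx : x = n + 1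
    · have := h.le ((hmem m (by simp)).resolve_left hm)
      omega
    · exact h.2 m x (by simpa [hm, hx] using hf)

lemma IsStirlingPerm.exists_insertPair {n : ℕ} {l : List ℕ} (h : IsStirlingPerm (n + 1) l) :
    ∃ l' i, IsStirlingPerm n l' ∧ i < 2 * n + 1 ∧ _root_.insertPair (n + 1) i l' = l := by
  have hcount : l.count (n + 1) = 2 := by
    rw [← Multiset.coe_count, h.1, two_nsmul_Icc_succ_val]
    simp
  have hmem : n + 1 ∈ l := List.count_pos_iff.1 (by omega)
  obtain ⟨p, t, rfl, hp⟩ := List.eq_append_cons_of_mem hmem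
  have ht : n + 1 ∈ t := by
    rw [List.count_append, List.count_cons_self, List.count_eq_zero_of_not_mem hp] at hcount
    exact List.count_pos_iff.1 (by omega)
  obtain ⟨q, r, rfl, hq⟩ := List.eq_append_cons_of_mem ht
  have hq0 : q = [] := by
    rcases q with _ | ⟨a, q⟩
    · rfl
    · have hs : [n + 1, a, n + 1].Sublist (p ++ (n + 1) :: (a :: q ++ (n + 1) :: r)) := by
        refine List.Sublist.trans ?_ (List.sublist_append_right _ _)
        rw [List.cons_sublist_cons, List.cons_append, List.cons_sublist_cons]
        exact List.singleton_sublist.2 (by simp)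
      have h1 := h.2 _ _ hs
      have h2 := h.le (x := a) (by simp)
      omega
  subst hq0
  have hins : _root_.insertPair (n + 1) p.length (p ++ r) =
      p ++ (n + 1) :: ([] ++ (n + 1) :: r) := by
    simp [_root_.insertPair]
  have hst : IsStirlingPerm n (p ++ r) := by
    refine ⟨?_, fun m x hs => h.2 m x (hs.trans ?_)⟩
    · have h1 := h.1
      rw [← hins, coe_insertPair, two_nsmul_Icc_succ_val, Multiset.cons_inj_right,
        Multiset.cons_inj_right] at h1
      exact h1
    · exact (List.Sublist.refl p).append
        ((List.sublist_cons_self _ _).trans (List.sublist_cons_self _ _))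
  refine ⟨p ++ r, p.length, hst, ?_, hins⟩
  have := hst.length
  rw [List.length_append] at this
  omega

lemma mem_stirlingPerms {n : ℕ} {l : List ℕ} : l ∈ stirlingPerms n ↔ IsStirlingPerm n l := by
  induction n generalizing l with
  | zero =>
    rw [stirlingPerms, Finset.mem_singleton]
    constructor
    · rintro rfl
      exact ⟨by simp, fun m x hs => by simp at hs⟩
    · intro h
      exact List.eq_nil_of_length_eq_zero (by simpa using h.length)
  | succ n ih =>
    simp only [stirlingPerms, Finset.mem_image, Finset.mem_product, Finset.mem_range, Prod.exists]
    constructor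
    · rintro ⟨l', i, ⟨hl', -⟩, rfl⟩
      exact (ih.1 hl').insertPair i
    · intro h
      obtain ⟨l', i, hl', hi, he⟩ := h.exists_insertPair
      exact ⟨l', i, ⟨ih.2 hl', hi⟩, he⟩

lemma secondOrderEulerian_eq_card (n k : ℕ) :
    secondOrderEulerian n k = ((stirlingPerms n).filter (descentCount · = k)).card := by
  rw [secondOrderEulerian, ← Set.ncard_coe_finset]
  congr 1
  ext l
  simp [mem_stirlingPerms]

lemma sum_stirlingPerms_succ {M : Type*} [AddCommMonoid M] (n : ℕ) (f : List ℕ → M) :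
    ∑ l ∈ stirlingPerms (n + 1), f l =
      ∑ l ∈ stirlingPerms n, ∑ i ∈ Finset.range (2 * n + 1), f (insertPair (n + 1) i l) := by
  rw [stirlingPerms, Finset.sum_image, Finset.sum_product]
  rintro ⟨l, i⟩ h ⟨l', i'⟩ h' heq
  simp only [Finset.coe_product, Set.mem_prod, Finset.mem_coe, mem_stirlingPerms,
    Finset.mem_range] at h h' heq
  have hn : n + 1 ∉ l := fun hl => by have := h.1.le hl; omega
  have hn' : n + 1 ∉ l' := fun hl => by have := h'.1.le hl; omega
  have h1 := filter_insertPair hn i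
  have h2 := idxOf_insertPair hn (i := i) (by rw [h.1.length]; omega)
  rw [heq, filter_insertPair hn'] at h1
  rw [heq, idxOf_insertPair hn' (by rw [h'.1.length]; omega)] at h2
  rw [h1, h2]

lemma descentCount_cons_cons (a b : ℕ) (l : List ℕ) :
    descentCount (a :: b :: l) = (if b < a then 1 else 0) + descentCount (b :: l) := rfl

lemma sum_descentCount_insertPair_succ {R : Type*} [CommRing R] {m : ℕ} (l : List ℕ) :
    ∀ (a : ℕ) (φ : ℕ → R), (∀ x ∈ a :: l, x < m) →
      ∑ i ∈ Finset.range (l.length + 1), φ (descentCount (insertPair m (i + 1) (a :: l))) =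
        (descentCount (a :: l) : R) * φ (descentCount (a :: l)) +
          ((l.length : R) + 1 - descentCount (a :: l)) * φ (descentCount (a :: l) + 1) := by
  induction l with
  | nil =>
    intro a φ h
    have ha : ¬ m < a := by have := h a (by simp); omega
    simp [insertPair, descentCount, ha]
  | cons b l ih =>
    intro a φ h
    have ha : ¬ m < a := by have := h a (by simp); omega
    have hb : b < m := h b (by simp)
    have key : ∀ i, descentCount (insertPair m (i + 1 + 1) (a :: b :: l)) =
        (if b < a then 1 else 0) + descentCount (insertPair m (i + 1) (b :: l)) := fun i => by
      rw [insertPair_succ_cons, insertPair_succ_cons, descentCount_cons_cons]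
    have h0 : descentCount (insertPair m (0 + 1) (a :: b :: l)) = descentCount (b :: l) + 1 := by
      simp [insertPair, descentCount_cons_cons, ha, hb, add_comm]
    rw [List.length_cons, Finset.sum_range_succ', h0]
    simp only [key]
    rw [ih b (fun d => φ ((if b < a then 1 else 0) + d)) fun x hx => h x (by simp [hx]),
      descentCount_cons_cons]
    split_ifs with hba
    · rw [add_comm 1 (descentCount (b :: l)), ← add_assoc, add_comm 1 (descentCount (b :: l))]
      push_cast
      ring
    · simp only [zero_add]
      push_cast
      ring

/-- Inserting a pair larger than all entries preserves the number of descents at exactly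
`descentCount l` of the gaps and raises it by one at all others. -/
lemma sum_descentCount_insertPair {R : Type*} [CommRing R] {m : ℕ} (l : List ℕ) (φ : ℕ → R)
    (h : ∀ x ∈ l, x < m) :
    ∑ i ∈ Finset.range (l.length + 1), φ (descentCount (insertPair m i l)) =
      (descentCount l : R) * φ (descentCount l) +
        ((l.length : R) + 1 - descentCount l) * φ (descentCount l + 1) := by
  rcases l with _ | ⟨a, l⟩
  · simp [insertPair, descentCount]
  · have ha : a < m := h a (by simp)
    have h0 : descentCount (insertPair m 0 (a :: l)) = descentCount (a :: l) + 1 := by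
      simp [insertPair, descentCount_cons_cons, ha, add_comm]
    rw [List.length_cons, Finset.sum_range_succ', h0,
      sum_descentCount_insertPair_succ l a φ h]
    push_cast
    ring

lemma descentCount_insertPair_le {m : ℕ} (l : List ℕ) (h : ∀ x ∈ l, x < m) (i : ℕ) :
    descentCount (insertPair m i l) ≤ descentCount l + 1 := by
  induction l generalizing i with
  | nil => simp [insertPair, descentCount]
  | cons a l ih =>
    have ha := h a (by simp)
    have ha' := ha.not_gt
    rcases i with _ | i
    · simp [insertPair, descentCount_cons_cons, ha, add_comm]
    · rw [insertPair_succ_cons]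
      rcases l with _ | ⟨b, l⟩
      · simp [insertPair, descentCount, ha']
      · have hb := h b (by simp)
        rcases i with _ | i
        · simp only [insertPair, descentCount_cons_cons, List.take_zero, List.drop_zero,
            List.nil_append, hb, ha', if_true, if_false, lt_irrefl]
          omega
        · have := ih (fun x hx => h x (by simp [hx])) (i + 1)
          rw [insertPair_succ_cons] at this ⊢
          rw [descentCount_cons_cons, descentCount_cons_cons, add_assoc]
          exact Nat.add_le_add_left this _

lemma one_le_descentCount (a : ℕ) (l : List ℕ) : 1 ≤ descentCount (a :: l) := by
  induction l generalizing a with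
  | nil => simp [descentCount]
  | cons b l ih => exact (ih b).trans (by simp [descentCount_cons_cons])

lemma descentCount_le_of_mem_stirlingPerms {n : ℕ} {l : List ℕ} (hl : l ∈ stirlingPerms n) :
    descentCount l ≤ n := by
  induction n generalizing l with
  | zero =>
    rw [stirlingPerms, Finset.mem_singleton] at hl
    simp [hl, descentCount]
  | succ n ih =>
    simp only [stirlingPerms, Finset.mem_image, Finset.mem_product, Prod.exists] at hl
    obtain ⟨l', i, ⟨hl', -⟩, rfl⟩ := hl
    exact (descentCount_insertPair_le l'
      (fun x hx => Nat.lt_succ_of_le ((mem_stirlingPerms.1 hl').le hx)) i).trans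
      (Nat.succ_le_succ (ih hl'))

lemma one_le_descentCount_of_mem_stirlingPerms {n : ℕ} (hn : 1 ≤ n) {l : List ℕ}
    (hl : l ∈ stirlingPerms n) : 1 ≤ descentCount l := by
  have h := (mem_stirlingPerms.1 hl).length
  rcases l with _ | ⟨a, l⟩
  · simp at h
    omega
  · exact one_le_descentCount a l

lemma sum_mul_secondOrderEulerian {R : Type*} [CommSemiring R] {n : ℕ} (hn : 1 ≤ n)
    (f : ℕ → R) :
    ∑ k ∈ Finset.Icc 1 n, f k * (secondOrderEulerian n k : R) =
      ∑ l ∈ stirlingPerms n, f (descentCount l) := by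
  rw [← Finset.sum_fiberwise_of_maps_to (s := stirlingPerms n) (t := Finset.Icc 1 n)
    (g := descentCount) fun l hl => Finset.mem_Icc.2
      ⟨one_le_descentCount_of_mem_stirlingPerms hn hl, descentCount_le_of_mem_stirlingPerms hl⟩]
  refine Finset.sum_congr rfl fun k _ => ?_
  rw [Finset.sum_congr rfl fun l hl => by rw [(Finset.mem_filter.1 hl).2], Finset.sum_const,
    secondOrderEulerian_eq_card, nsmul_eq_mul, mul_comm]

/-- The sum over Stirling permutations `l` of order `n` of `(-X) ^ d * (1 - X) ^ (n - d)`, where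
`d` is the number of descents of `l`. -/
noncomputable def stirlingPermPoly (n : ℕ) : Polynomial ℚ :=
  ∑ l ∈ stirlingPerms n,
    (-Polynomial.X) ^ descentCount l * (1 - Polynomial.X) ^ (n - descentCount l)

lemma stirlingPermPoly_zero : stirlingPermPoly 0 = 1 := by
  simp [stirlingPermPoly, stirlingPerms, descentCount]

lemma X_mul_derivative_neg_X_pow (d : ℕ) :
    Polynomial.X * Polynomial.derivative ((-Polynomial.X : Polynomial ℚ) ^ d) =
      (d : Polynomial ℚ) * (-Polynomial.X) ^ d := by
  rcases d with _ | d
  · simp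
  · rw [Polynomial.derivative_pow_succ, pow_succ]
    simp
    ring

lemma one_sub_X_mul_derivative_one_sub_X_pow (d : ℕ) :
    (1 - Polynomial.X) * Polynomial.derivative ((1 - Polynomial.X : Polynomial ℚ) ^ d) =
      -(d : Polynomial ℚ) * (1 - Polynomial.X) ^ d := by
  rcases d with _ | d
  · simp
  · rw [Polynomial.derivative_pow_succ, pow_succ]
    simp
    ring

lemma stirlingPermPoly_succ (n : ℕ) :
    stirlingPermPoly (n + 1) =
      Polynomial.X * (1 - Polynomial.X) * Polynomial.derivative (stirlingPermPoly n) -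
        ((n : Polynomial ℚ) + 1) * Polynomial.X * stirlingPermPoly n := by
  rw [stirlingPermPoly, sum_stirlingPerms_succ, stirlingPermPoly, Polynomial.derivative_sum,
    Finset.mul_sum, Finset.mul_sum, ← Finset.sum_sub_distrib]
  refine Finset.sum_congr rfl fun l hl => ?_
  have hst := mem_stirlingPerms.1 hl
  have hd := descentCount_le_of_mem_stirlingPerms hl
  have h := sum_descentCount_insertPair (R := Polynomial ℚ) (m := n + 1) l
    (fun d => (-Polynomial.X) ^ d * (1 - Polynomial.X) ^ (n + 1 - d))
    fun x hx => Nat.lt_succ_of_le (hst.le hx)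
  rw [hst.length] at h
  rw [h, Nat.add_sub_add_right, Nat.succ_sub hd, pow_succ, pow_succ, Polynomial.derivative_mul]
  have h1 := X_mul_derivative_neg_X_pow (descentCount l)
  have h2 := one_sub_X_mul_derivative_one_sub_X_pow (n - descentCount l)
  rw [Nat.cast_sub hd] at h2
  push_cast
  linear_combination (-(1 - Polynomial.X) * (1 - Polynomial.X) ^ (n - descentCount l)) * h1 -
    Polynomial.X * (-Polynomial.X) ^ descentCount l * h2

/-- Integration over the unit interval, as a linear functional on polynomials. -/
noncomputable def unitIntegral : Polynomial ℚ →ₗ[ℚ] ℚ :=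
  Polynomial.lsum fun i => ((1 : ℚ) / (i + 1)) • LinearMap.id

lemma unitIntegral_derivative (p : Polynomial ℚ) :
    unitIntegral (Polynomial.derivative p) = p.eval 1 - p.eval 0 := by
  induction p using Polynomial.induction_on' with
  | add p q hp hq => simp only [map_add, hp, hq, Polynomial.eval_add]; ring
  | monomial n a =>
    rcases n with _ | n
    · simp
    · have : (n : ℚ) + 1 ≠ 0 := by positivity
      simp [unitIntegral]
      field_simp

lemma unitIntegral_X_pow (a : ℕ) : unitIntegral (Polynomial.X ^ a) = 1 / ((a : ℚ) + 1) := by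
  simp [unitIntegral, Polynomial.X_pow_eq_monomial]

lemma unitIntegral_natCast_mul (c : ℕ) (p : Polynomial ℚ) :
    unitIntegral ((c : Polynomial ℚ) * p) = c * unitIntegral p := by
  rw [← nsmul_eq_mul, map_nsmul, nsmul_eq_mul]

lemma unitIntegral_X_pow_mul_one_sub_X_pow (a b : ℕ) :
    unitIntegral (Polynomial.X ^ a * (1 - Polynomial.X) ^ b) =
      (a.factorial * b.factorial : ℚ) / (a + b + 1).factorial := by
  induction b generalizing a with
  | zero =>
    have : (a.factorial : ℚ) ≠ 0 := by positivity
    rw [pow_zero, mul_one, unitIntegral_X_pow, add_zero, Nat.factorial_succ]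
    push_cast
    field_simp
    simp
  | succ b ih =>
    have h := unitIntegral_derivative (Polynomial.X ^ (a + 1) * (1 - Polynomial.X) ^ (b + 1))
    have hd : Polynomial.derivative
        (Polynomial.X ^ (a + 1) * (1 - Polynomial.X) ^ (b + 1) : Polynomial ℚ) =
        ((a + 1 : ℕ) : Polynomial ℚ) * (Polynomial.X ^ a * (1 - Polynomial.X) ^ (b + 1)) -
        ((b + 1 : ℕ) : Polynomial ℚ) * (Polynomial.X ^ (a + 1) * (1 - Polynomial.X) ^ b) := by
      rw [Polynomial.derivative_mul, Polynomial.derivative_pow_succ,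
        Polynomial.derivative_pow_succ]
      simp
      ring
    rw [hd, map_sub, unitIntegral_natCast_mul, unitIntegral_natCast_mul, ih] at h
    simp only [Polynomial.eval_mul, Polynomial.eval_pow, Polynomial.eval_X, Polynomial.eval_sub,
      Polynomial.eval_one, sub_self, ne_eq, Nat.add_eq_zero_iff, one_ne_zero, and_false,
      not_false_eq_true, zero_pow, mul_zero, zero_mul] at h
    rw [show a + (b + 1) + 1 = a + 1 + b + 1 by ring, Nat.factorial_succ b]
    rw [Nat.factorial_succ a] at h
    have ha : ((a + 1 : ℕ) : ℚ) ≠ 0 := by positivity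
    apply mul_left_cancel₀ ha
    push_cast at h ⊢
    linear_combination h

lemma inv_choose_eq_unitIntegral {m a : ℕ} (h : a ≤ m) :
    ((m.choose a : ℚ))⁻¹ =
      (m + 1) * unitIntegral (Polynomial.X ^ a * (1 - Polynomial.X) ^ (m - a)) := by
  rw [unitIntegral_X_pow_mul_one_sub_X_pow, Nat.add_sub_cancel' h, Nat.factorial_succ,
    Nat.cast_choose ℚ h]
  have : (m.factorial : ℚ) ≠ 0 := by positivity
  push_cast
  field_simp

lemma sum_inv_choose_mul_secondOrderEulerian {n N : ℕ} (hN : 1 ≤ N) (hn : N ≤ n) :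
    ∑ k ∈ Finset.Icc 1 n,
        (-1 : ℚ) ^ k * ((Nat.choose (2 * n - 1) (N + k - 1) : ℚ))⁻¹ *
          (secondOrderEulerian n k : ℚ) =
      2 * n * unitIntegral
        (Polynomial.X ^ (N - 1) * (1 - Polynomial.X) ^ (n - N) * stirlingPermPoly n) := by
  rw [sum_mul_secondOrderEulerian (hN.trans hn)
    fun k => (-1 : ℚ) ^ k * ((Nat.choose (2 * n - 1) (N + k - 1) : ℚ))⁻¹, stirlingPermPoly,
    Finset.mul_sum, map_sum, Finset.mul_sum]
  refine Finset.sum_congr rfl fun l hl => ?_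
  have hd := descentCount_le_of_mem_stirlingPerms hl
  have h1 : (Polynomial.X ^ (N - 1) * (1 - Polynomial.X) ^ (n - N) *
      ((-Polynomial.X) ^ descentCount l * (1 - Polynomial.X) ^ (n - descentCount l)) :
        Polynomial ℚ) = ((-1 : ℚ) ^ descentCount l) •
      (Polynomial.X ^ (N + descentCount l - 1) *
        (1 - Polynomial.X) ^ (2 * n - 1 - (N + descentCount l - 1))) := by
    rw [show N + descentCount l - 1 = (N - 1) + descentCount l by omega,
      show 2 * n - 1 - ((N - 1) + descentCount l) = (n - N) + (n - descentCount l) by omega,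
      pow_add, pow_add, neg_pow, Polynomial.smul_eq_C_mul]
    simp
    ring
  rw [h1, map_smul, inv_choose_eq_unitIntegral (by omega), Nat.cast_sub (by omega), smul_eq_mul]
  push_cast
  ring

lemma unitIntegral_stirlingPermPoly_succ {m N : ℕ} (hN : 1 ≤ N) (hm : N ≤ m) :
    unitIntegral (Polynomial.X ^ N * (1 - Polynomial.X) ^ (m - N) * stirlingPermPoly (m + 1)) +
      unitIntegral
        (Polynomial.X ^ (N - 1) * (1 - Polynomial.X) ^ (m + 1 - N) * stirlingPermPoly (m + 1)) =
      -N * unitIntegral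
        (Polynomial.X ^ (N - 1) * (1 - Polynomial.X) ^ (m - N) * stirlingPermPoly m) := by
  obtain ⟨N, rfl⟩ := Nat.exists_eq_add_of_le' hN
  obtain ⟨r, rfl⟩ := Nat.exists_eq_add_of_le hm
  have h := unitIntegral_derivative
    (Polynomial.X ^ (N + 1) * (1 - Polynomial.X) ^ (r + 1) * stirlingPermPoly (N + 1 + r))
  have h0 : (Polynomial.X ^ (N + 1) * (1 - Polynomial.X) ^ (r + 1) *
      stirlingPermPoly (N + 1 + r)).eval 1 -
      (Polynomial.X ^ (N + 1) * (1 - Polynomial.X) ^ (r + 1) *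
      stirlingPermPoly (N + 1 + r)).eval 0 = 0 := by simp
  rw [h0] at h
  rw [neg_mul, ← unitIntegral_natCast_mul, ← map_add, ← map_neg, ← sub_eq_zero, ← map_sub, ← h]
  congr 1
  rw [show N + 1 + r - (N + 1) = r by omega, show N + 1 + r + 1 - (N + 1) = r + 1 by omega,
    Nat.add_sub_cancel, stirlingPermPoly_succ, Polynomial.derivative_mul,
    Polynomial.derivative_mul, Polynomial.derivative_pow_succ, Polynomial.derivative_pow_succ]
  simp
  ring

lemma sum_stirlingFirst_succ (f : ℕ → ℚ) {m N : ℕ} (hN : 1 ≤ N) :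
    ∑ k ∈ Finset.range (N + 1), (Nat.stirlingFirst (N + 1) (N + 1 - k) : ℚ) * f (m + 1 - k) =
      ∑ k ∈ Finset.range N, (Nat.stirlingFirst N (N - k) : ℚ) * f (m + 1 - k) +
        N * ∑ k ∈ Finset.range N, (Nat.stirlingFirst N (N - k) : ℚ) * f (m - k) := by
  have h : ∀ k ∈ Finset.range (N + 1),
      (Nat.stirlingFirst (N + 1) (N + 1 - k) : ℚ) * f (m + 1 - k) =
        (Nat.stirlingFirst N (N - k) : ℚ) * f (m + 1 - k) +
          N * ((Nat.stirlingFirst N (N + 1 - k) : ℚ) * f (m + 1 - k)) := fun k hk => by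
    rw [Finset.mem_range] at hk
    rw [show N + 1 - k = N - k + 1 by omega, Nat.stirlingFirst_succ_succ]
    push_cast
    ring
  rw [Finset.sum_congr rfl h, Finset.sum_add_distrib, Finset.sum_range_succ, ← Finset.mul_sum,
    Finset.sum_range_succ']
  have h0 : Nat.stirlingFirst N 0 = 0 := by
    obtain ⟨N, rfl⟩ := Nat.exists_eq_add_of_le' hN
    rfl
  simp [h0, Nat.stirlingFirst_eq_zero_of_lt]

/-- `(exp X - 1) / X` as a formal power series. -/
noncomputable def expSubOneDivX : PowerSeries ℚ := PowerSeries.mk fun n => 1 / (n + 1).factorial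

lemma X_mul_expSubOneDivX : PowerSeries.X * expSubOneDivX = PowerSeries.exp ℚ - 1 := by
  ext n
  rcases n with _ | n
  · simp
  · simp [PowerSeries.coeff_succ_X_mul, expSubOneDivX, PowerSeries.coeff_exp,
      PowerSeries.coeff_one]

lemma constantCoeff_expSubOneDivX : PowerSeries.constantCoeff expSubOneDivX = 1 := by
  simp [expSubOneDivX]

lemma X_mul_derivative_expSubOneDivX :
    PowerSeries.X * PowerSeries.derivative ℚ expSubOneDivX + expSubOneDivX =
      PowerSeries.X * expSubOneDivX + 1 := by
  ext n
  rcases n with _ | n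
  · simp [expSubOneDivX]
  · simp only [map_add, PowerSeries.coeff_succ_X_mul, PowerSeries.coeff_derivative, expSubOneDivX,
      PowerSeries.coeff_mk, PowerSeries.coeff_one, Nat.factorial_succ (n + 1)]
    have : ((n + 1).factorial : ℚ) ≠ 0 := by positivity
    have : (n : ℚ) + 1 + 1 ≠ 0 := by positivity
    push_cast
    field_simp
    simp

lemma bernoulliPowerSeries_mul_expSubOneDivX :
    bernoulliPowerSeries ℚ * expSubOneDivX = 1 := by
  apply mul_left_cancel₀ (PowerSeries.X_ne_zero (R := ℚ))
  rw [mul_left_comm, X_mul_expSubOneDivX, bernoulliPowerSeries_mul_exp_sub_one, mul_one]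

lemma coeff_expSubOneDivX_sub_one_pow_eq_zero {n k : ℕ} (h : n < k) :
    PowerSeries.coeff n ((expSubOneDivX - 1) ^ k) = 0 := by
  apply PowerSeries.coeff_of_lt_order
  refine lt_of_lt_of_le (by exact_mod_cast h)
    (PowerSeries.le_order_pow_of_constantCoeff_eq_zero k ?_)
  simp [constantCoeff_expSubOneDivX]

lemma coeff_succ_expSubOneDivX_sub_one_pow_succ (n k : ℕ) :
    ((n : ℚ) + k + 2) * PowerSeries.coeff (n + 1) ((expSubOneDivX - 1) ^ (k + 1)) =
      (k + 1) * (PowerSeries.coeff n ((expSubOneDivX - 1) ^ (k + 1)) +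
        PowerSeries.coeff n ((expSubOneDivX - 1) ^ k)) := by
  have h : PowerSeries.X * PowerSeries.derivative ℚ ((expSubOneDivX - 1) ^ (k + 1)) +
      (k + 1 : ℚ) • (expSubOneDivX - 1) ^ (k + 1) =
      (k + 1 : ℚ) •
        (PowerSeries.X * ((expSubOneDivX - 1) ^ (k + 1) + (expSubOneDivX - 1) ^ k)) := by
    rw [PowerSeries.derivative_pow, map_sub, PowerSeries.derivative_one, PowerSeries.smul_eq_C_mul,
      PowerSeries.smul_eq_C_mul]
    simp
    linear_combination ((k : PowerSeries ℚ) + 1) * (expSubOneDivX - 1) ^ k *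
      X_mul_derivative_expSubOneDivX
  have h' := congrArg (PowerSeries.coeff (n + 1)) h
  simp only [map_add, PowerSeries.coeff_succ_X_mul, PowerSeries.coeff_derivative,
    PowerSeries.coeff_smul, smul_eq_mul] at h'
  linear_combination h'

lemma coeff_stirlingPermPoly (n k : ℕ) :
    (stirlingPermPoly n).coeff k =
      (-1) ^ k * ((n + k).factorial / k.factorial *
        PowerSeries.coeff n ((expSubOneDivX - 1) ^ k)) := by
  induction n generalizing k with
  | zero =>
    rw [stirlingPermPoly_zero]
    rcases k with _ | k
    · simp
    · rw [coeff_expSubOneDivX_sub_one_pow_eq_zero (by omega), Polynomial.coeff_one]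
      simp
  | succ n ih =>
    have hrw : stirlingPermPoly (n + 1) =
        Polynomial.X * (Polynomial.derivative (stirlingPermPoly n) -
          Polynomial.X * Polynomial.derivative (stirlingPermPoly n) -
          ((n + 1 : ℕ) : Polynomial ℚ) * stirlingPermPoly n) := by
      rw [stirlingPermPoly_succ]
      push_cast
      ring
    rw [hrw]
    rcases k with _ | k
    · simp [PowerSeries.coeff_one]
    · have hrec := coeff_succ_expSubOneDivX_sub_one_pow_succ n k
      have hX : (Polynomial.X * Polynomial.derivative (stirlingPermPoly n)).coeff k =
          k * (stirlingPermPoly n).coeff k := by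
        rcases k with _ | k
        · simp
        · rw [Polynomial.coeff_X_mul, Polynomial.coeff_derivative]
          push_cast
          ring
      rw [Polynomial.coeff_X_mul, Polynomial.coeff_sub, Polynomial.coeff_sub, hX,
        Polynomial.coeff_natCast_mul, Polynomial.coeff_derivative, ih, ih,
        show n + 1 + (k + 1) = n + k + 1 + 1 by ring, show n + (k + 1) = n + k + 1 by ring,
        Nat.factorial_succ (n + k + 1), Nat.factorial_succ (n + k), Nat.factorial_succ k]
      have hk : (k.factorial : ℚ) ≠ 0 := by positivity
      have hk1 : (k : ℚ) + 1 ≠ 0 := by positivity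
      push_cast
      field_simp
      rw [pow_succ (-1 : ℚ) k]
      linear_combination ((-1) ^ k * ((n : ℚ) + k + 1)) * hrec

lemma natDegree_stirlingPermPoly_lt (n : ℕ) : (stirlingPermPoly n).natDegree < n + 1 := by
  rw [Nat.lt_succ_iff, Polynomial.natDegree_le_iff_coeff_eq_zero]
  intro k hk
  rw [coeff_stirlingPermPoly, coeff_expSubOneDivX_sub_one_pow_eq_zero hk]
  simp

lemma unitIntegral_one_sub_X_pow_mul_stirlingPermPoly (n : ℕ) :
    unitIntegral ((1 - Polynomial.X) ^ n * stirlingPermPoly (n + 1)) =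
      bernoulli (n + 1) / (n + 1) := by
  have hinv : bernoulliPowerSeries ℚ =
      ∑ k ∈ Finset.range (n + 2), (-(expSubOneDivX - 1)) ^ k +
        bernoulliPowerSeries ℚ * (-(expSubOneDivX - 1)) ^ (n + 2) := by
    have h := mul_neg_geom_sum (-(expSubOneDivX - 1)) (n + 2)
    linear_combination (-bernoulliPowerSeries ℚ) * h +
      (∑ k ∈ Finset.range (n + 2), (-(expSubOneDivX - 1)) ^ k) *
        bernoulliPowerSeries_mul_expSubOneDivX
  have htail : PowerSeries.coeff (n + 1)
      (bernoulliPowerSeries ℚ * (-(expSubOneDivX - 1)) ^ (n + 2)) = 0 := by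
    apply PowerSeries.coeff_of_lt_order
    refine lt_of_lt_of_le ?_ (PowerSeries.le_order_mul _ _)
    refine lt_of_lt_of_le ?_ le_add_self
    refine lt_of_lt_of_le ?_ (PowerSeries.le_order_pow_of_constantCoeff_eq_zero (n + 2) ?_)
    · exact_mod_cast Nat.lt_succ_self _
    · simp [constantCoeff_expSubOneDivX]
  have hb := congrArg (PowerSeries.coeff (n + 1)) hinv
  rw [map_add, htail, add_zero, map_sum, bernoulliPowerSeries, PowerSeries.coeff_mk] at hb
  rw [Polynomial.as_sum_range' _ _ (natDegree_stirlingPermPoly_lt (n + 1)), Finset.mul_sum, map_sum]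
  have hterm : ∀ k ∈ Finset.range (n + 2),
      unitIntegral ((1 - Polynomial.X) ^ n *
        Polynomial.monomial k ((stirlingPermPoly (n + 1)).coeff k)) =
      n.factorial * PowerSeries.coeff (n + 1) ((-(expSubOneDivX - 1)) ^ k) := fun k _ => by
    rw [← Polynomial.C_mul_X_pow_eq_monomial, mul_left_comm, ← Polynomial.smul_eq_C_mul, map_smul,
      mul_comm ((1 - Polynomial.X) ^ n), unitIntegral_X_pow_mul_one_sub_X_pow,
      coeff_stirlingPermPoly, show n + 1 + k = k + n + 1 by ring, neg_pow (expSubOneDivX - 1),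
      show ((-1) ^ k : PowerSeries ℚ) = PowerSeries.C ((-1) ^ k) by simp,
      PowerSeries.coeff_C_mul, smul_eq_mul]
    have h1 : (k.factorial : ℚ) ≠ 0 := by positivity
    have h2 : ((k + n + 1).factorial : ℚ) ≠ 0 := by positivity
    field_simp
  rw [Finset.sum_congr rfl hterm, ← Finset.mul_sum, ← hb, Nat.factorial_succ]
  have h1 : (n.factorial : ℚ) ≠ 0 := by positivity
  simp
  field_simp

lemma unitIntegral_stirlingPermPoly {N n : ℕ} (hN : 1 ≤ N) (hn : N ≤ n) :
    unitIntegral (Polynomial.X ^ (N - 1) * (1 - Polynomial.X) ^ (n - N) * stirlingPermPoly n) =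
      (-1) ^ (N - 1) * ∑ k ∈ Finset.range N,
        (Nat.stirlingFirst N (N - k) : ℚ) * (bernoulli (n - k) / ((n - k : ℕ) : ℚ)) := by
  induction N, hN using Nat.le_induction generalizing n with
  | base =>
    obtain ⟨n, rfl⟩ := Nat.exists_eq_add_of_le' hn
    simp [unitIntegral_one_sub_X_pow_mul_stirlingPermPoly, Nat.stirlingFirst]
  | succ N hN ih =>
    obtain ⟨m, rfl⟩ := Nat.exists_eq_add_of_le' (hN.trans (Nat.le_of_succ_le hn))
    have hm : N ≤ m := by omega
    have hrec := unitIntegral_stirlingPermPoly_succ hN hm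
    rw [ih (n := m + 1) (by omega), ih hm] at hrec
    have hs := sum_stirlingFirst_succ (fun j => bernoulli j / (j : ℚ)) (m := m) hN
    obtain ⟨N, rfl⟩ := Nat.exists_eq_add_of_le' hN
    simp only [Nat.add_sub_cancel, Nat.add_sub_add_right] at hrec hs ⊢
    rw [hs, pow_succ (-1 : ℚ) N]
    linear_combination hrec

lemma sum_inv_choose_mul_secondOrderEulerian_eq_bernoulli {n N : ℕ} (hN : 1 ≤ N) (hn : N ≤ n) :
    ∑ k ∈ Finset.Icc 1 n,
        (-1 : ℚ) ^ k * ((Nat.choose (2 * n - 1) (N + k - 1) : ℚ))⁻¹ *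
          (secondOrderEulerian n k : ℚ) =
      2 * n * ((-1) ^ (N - 1) * ∑ k ∈ Finset.range N,
        (Nat.stirlingFirst N (N - k) : ℚ) * (bernoulli (n - k) / ((n - k : ℕ) : ℚ))) := by
  rw [sum_inv_choose_mul_secondOrderEulerian hN hn, unitIntegral_stirlingPermPoly hN hn]

/-- The power series `-log (1 - X)`. -/
noncomputable def negLogOneSubX : PowerSeries ℚ := -PowerSeries.logOf (1 - PowerSeries.X)

lemma constantCoeff_negLogOneSubX : PowerSeries.constantCoeff negLogOneSubX = 0 := by
  rw [negLogOneSubX, map_neg, PowerSeries.constantCoeff_logOf (by simp), neg_zero]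

lemma hasSubst_negLogOneSubX : PowerSeries.HasSubst negLogOneSubX :=
  PowerSeries.HasSubst.of_constantCoeff_zero' constantCoeff_negLogOneSubX

lemma derivative_log_mul_one_add_X :
    PowerSeries.derivative ℚ (PowerSeries.log ℚ) * (1 + PowerSeries.X) = 1 := by
  rw [PowerSeries.deriv_log]
  ext n
  rcases n with _ | n
  · simp
  · rw [mul_add, mul_one, map_add, PowerSeries.coeff_succ_mul_X]
    simp [pow_succ, PowerSeries.coeff_one]

lemma derivative_negLogOneSubX_mul :
    PowerSeries.derivative ℚ negLogOneSubX * (1 - PowerSeries.X) = 1 := by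
  have hs : PowerSeries.HasSubst (1 - PowerSeries.X - 1 : PowerSeries ℚ) :=
    PowerSeries.HasSubst.of_constantCoeff_zero' (by simp)
  have h := congrArg (PowerSeries.subst (1 - PowerSeries.X - 1 : PowerSeries ℚ))
    derivative_log_mul_one_add_X
  rw [PowerSeries.subst_mul hs, PowerSeries.subst_add hs, PowerSeries.subst_X hs,
    ← PowerSeries.coe_substAlgHom hs, map_one, PowerSeries.coe_substAlgHom hs] at h
  rw [negLogOneSubX, PowerSeries.logOf_eq, map_neg, PowerSeries.derivative_subst hs, map_sub,
    map_sub, PowerSeries.derivative_X, PowerSeries.derivative_one]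
  linear_combination h

lemma coeff_negLogOneSubX_pow (n k : ℕ) :
    (n.factorial : ℚ) * PowerSeries.coeff n (negLogOneSubX ^ k) =
      k.factorial * Nat.stirlingFirst n k := by
  induction n generalizing k with
  | zero =>
    rcases k with _ | k
    · simp [Nat.stirlingFirst]
    · simp [Nat.stirlingFirst, constantCoeff_negLogOneSubX]
  | succ n ih =>
    rcases k with _ | k
    · simp [Nat.stirlingFirst, PowerSeries.coeff_one]
    · have h : PowerSeries.derivative ℚ (negLogOneSubX ^ (k + 1)) -
          PowerSeries.X * PowerSeries.derivative ℚ (negLogOneSubX ^ (k + 1)) =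
          (k + 1 : ℚ) • negLogOneSubX ^ k := by
        rw [PowerSeries.derivative_pow, PowerSeries.smul_eq_C_mul]
        simp
        linear_combination ((k : PowerSeries ℚ) + 1) * negLogOneSubX ^ k *
          derivative_negLogOneSubX_mul
      have hX : PowerSeries.coeff n
          (PowerSeries.X * PowerSeries.derivative ℚ (negLogOneSubX ^ (k + 1))) =
          n * PowerSeries.coeff n (negLogOneSubX ^ (k + 1)) := by
        rcases n with _ | n
        · simp
        · rw [PowerSeries.coeff_succ_X_mul, PowerSeries.coeff_derivative]
          push_cast
          ring
      have h' := congrArg (PowerSeries.coeff n) h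
      rw [map_sub, hX, PowerSeries.coeff_derivative, PowerSeries.coeff_smul, smul_eq_mul] at h'
      have h1 := ih (k + 1)
      have h2 := ih k
      rw [Nat.stirlingFirst_succ_succ]
      rw [Nat.factorial_succ] at h1 ⊢
      rw [Nat.factorial_succ]
      push_cast at h1 ⊢
      linear_combination (n.factorial : ℚ) * h' + n * h1 + (k + 1) * h2

lemma subst_exp_negLogOneSubX :
    (PowerSeries.exp ℚ).subst negLogOneSubX * (1 - PowerSeries.X) = 1 := by
  apply PowerSeries.derivative.ext
  · rw [Derivation.leibniz, PowerSeries.derivative_subst hasSubst_negLogOneSubX,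
      PowerSeries.derivative_exp, map_sub, PowerSeries.derivative_X, PowerSeries.derivative_one,
      smul_eq_mul, smul_eq_mul]
    linear_combination (PowerSeries.exp ℚ).subst negLogOneSubX * derivative_negLogOneSubX_mul
  · have h : PowerSeries.constantCoeff
        ((PowerSeries.exp ℚ - 1).subst negLogOneSubX : PowerSeries ℚ) = 0 :=
      PowerSeries.constantCoeff_subst_eq_zero constantCoeff_negLogOneSubX _
        (by simp [PowerSeries.constantCoeff_exp])
    rw [PowerSeries.subst_sub hasSubst_negLogOneSubX,
      ← PowerSeries.coe_substAlgHom hasSubst_negLogOneSubX, map_one, map_sub, sub_eq_zero,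
      PowerSeries.coe_substAlgHom] at h
    simp [h]

lemma subst_bernoulliPowerSeries_mul_X :
    (bernoulliPowerSeries ℚ).subst negLogOneSubX * PowerSeries.X =
      negLogOneSubX * (1 - PowerSeries.X) := by
  have h := congrArg (PowerSeries.subst negLogOneSubX) (bernoulliPowerSeries_mul_exp_sub_one ℚ)
  rw [PowerSeries.subst_mul hasSubst_negLogOneSubX, PowerSeries.subst_sub hasSubst_negLogOneSubX,
    PowerSeries.subst_X hasSubst_negLogOneSubX,
    ← PowerSeries.coe_substAlgHom hasSubst_negLogOneSubX, map_one,
    PowerSeries.coe_substAlgHom] at h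
  linear_combination (1 - PowerSeries.X) * h -
    (bernoulliPowerSeries ℚ).subst negLogOneSubX * subst_exp_negLogOneSubX

/-- The power series `∑ B_j X ^ j / (j * j!)`, summed over `j ≥ 1`. -/
noncomputable def bernoulliDivSeries : PowerSeries ℚ :=
  PowerSeries.mk fun j => bernoulli j / j / j.factorial

lemma X_mul_derivative_bernoulliDivSeries :
    PowerSeries.X * PowerSeries.derivative ℚ bernoulliDivSeries = bernoulliPowerSeries ℚ - 1 := by
  ext n
  rcases n with _ | n
  · simp [bernoulliPowerSeries]
  · have : (n : ℚ) + 1 ≠ 0 := by positivity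
    simp [PowerSeries.coeff_succ_X_mul, PowerSeries.coeff_derivative, bernoulliDivSeries,
      bernoulliPowerSeries, PowerSeries.coeff_one]
    field_simp

lemma coeff_subst_bernoulliDivSeries (n : ℕ) :
    (n.factorial : ℚ) * PowerSeries.coeff n (bernoulliDivSeries.subst negLogOneSubX) =
      ∑ k ∈ Finset.range (n + 1), (Nat.stirlingFirst n k : ℚ) * (bernoulli k / k) := by
  rw [PowerSeries.coeff_subst' hasSubst_negLogOneSubX,
    finsum_eq_sum_of_support_subset (s := Finset.range (n + 1)), Finset.mul_sum]
  · refine Finset.sum_congr rfl fun k _ => ?_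
    have h := coeff_negLogOneSubX_pow n k
    have hk : (k.factorial : ℚ) ≠ 0 := by positivity
    rw [smul_eq_mul, mul_left_comm, h, bernoulliDivSeries, PowerSeries.coeff_mk]
    field_simp
  · intro k hk
    by_contra hkn
    have hlt : n < k := by simpa using hkn
    have h := coeff_negLogOneSubX_pow n k
    rw [Nat.stirlingFirst_eq_zero_of_lt hlt, Nat.cast_zero, mul_zero, mul_eq_zero] at h
    have h0 := h.resolve_left (by positivity)
    simp [h0] at hk

/-- The exponential generating function of the Cauchy numbers of the second kind. -/
noncomputable def cauchySecondSeries : PowerSeries ℚ :=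
  1 - PowerSeries.X * PowerSeries.derivative ℚ (bernoulliDivSeries.subst negLogOneSubX)

lemma cauchySecondSeries_mul :
    cauchySecondSeries * ((1 - PowerSeries.X) * PowerSeries.logOf (1 - PowerSeries.X)) =
      -PowerSeries.X := by
  have h1 := congrArg (PowerSeries.subst negLogOneSubX) X_mul_derivative_bernoulliDivSeries
  rw [PowerSeries.subst_mul hasSubst_negLogOneSubX, PowerSeries.subst_sub hasSubst_negLogOneSubX,
    PowerSeries.subst_X hasSubst_negLogOneSubX,
    ← PowerSeries.coe_substAlgHom hasSubst_negLogOneSubX, map_one,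
    PowerSeries.coe_substAlgHom] at h1
  have hlog : PowerSeries.logOf (1 - PowerSeries.X) = -negLogOneSubX := by simp [negLogOneSubX]
  rw [cauchySecondSeries, PowerSeries.derivative_subst hasSubst_negLogOneSubX, hlog]
  linear_combination PowerSeries.X * negLogOneSubX *
      (PowerSeries.derivative ℚ bernoulliDivSeries).subst negLogOneSubX *
        derivative_negLogOneSubX_mul + PowerSeries.X * h1 + subst_bernoulliPowerSeries_mul_X

lemma cauchySecond_eq_coeff (n : ℕ) :
    cauchySecond n = n.factorial * PowerSeries.coeff n cauchySecondSeries := by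
  have h1 : ((1 - PowerSeries.X) * PowerSeries.logOf (1 - PowerSeries.X) : PowerSeries ℚ) ≠ 0 := by
    intro h
    have := cauchySecondSeries_mul
    rw [h, mul_zero] at this
    exact neg_ne_zero.2 PowerSeries.X_ne_zero this.symm
  rw [cauchySecond, ← HahnSeries.ofPowerSeries_apply_coeff (Γ := ℤ)]
  congr 2
  rw [div_eq_iff, ← map_mul, cauchySecondSeries_mul]
  exact fun h => h1 (HahnSeries.ofPowerSeries_injective (h.trans (map_zero _).symm))

lemma cauchySecond_eq_sum {n : ℕ} (hn : 1 ≤ n) :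
    cauchySecond n =
      -n * ∑ k ∈ Finset.range n,
        (Nat.stirlingFirst n (n - k) : ℚ) * (bernoulli (n - k) / ((n - k : ℕ) : ℚ)) := by
  have h := coeff_subst_bernoulliDivSeries n
  obtain ⟨m, rfl⟩ := Nat.exists_eq_add_of_le' hn
  rw [← Finset.sum_range_reflect, Finset.sum_range_succ] at h
  simp only [Nat.add_sub_cancel, Nat.sub_self, Nat.stirlingFirst_succ_zero, Nat.cast_zero, zero_mul,
    add_zero] at h
  rw [← h, cauchySecond_eq_coeff, cauchySecondSeries, map_sub, PowerSeries.coeff_succ_X_mul,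
    PowerSeries.coeff_derivative, PowerSeries.coeff_one, if_neg (Nat.succ_ne_zero m)]
  push_cast
  ring

theorem theorem4 :
    (∀ n N : ℕ, 1 ≤ N → N ≤ n →
      ∑ k ∈ Finset.Icc 1 n,
          (-1 : ℚ) ^ k * ((Nat.choose (2 * n - 1) (N + k - 1) : ℚ))⁻¹ *
            (secondOrderEulerian n k : ℚ) =
        2 * (n : ℚ) * ∑ k ∈ Finset.range N,
          (-1 : ℚ) ^ (N - 1 - k) * (stirlingFirstSigned N (N - k) : ℚ) *
            (bernoulli (n - k) / ((n : ℚ) - (k : ℚ)))) ∧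
    (∀ n : ℕ, 1 ≤ n →
      2 * cauchySecond n =
        ∑ k ∈ Finset.Icc 1 n,
          (-1 : ℚ) ^ (n - k) * ((Nat.choose (2 * n - 1) (n + k - 1) : ℚ))⁻¹ *
            (secondOrderEulerian n k : ℚ)) := by
  refine ⟨fun n N hN hn => ?_, fun n hn => ?_⟩
  · rw [sum_inv_choose_mul_secondOrderEulerian_eq_bernoulli hN hn, Finset.mul_sum]
    congr 1
    refine Finset.sum_congr rfl fun k hk => ?_
    have hk' := Finset.mem_range.1 hk
    have hsign : (-1 : ℚ) ^ (N - 1 - k) * (-1) ^ (N + (N - k)) = (-1) ^ (N - 1) := by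
      rw [← pow_add, show N - 1 - k + (N + (N - k)) = N - 1 + 2 * (N - k) by omega, pow_add,
        pow_mul]
      simp
    rw [stirlingFirstSigned, Nat.cast_sub (hk'.le.trans hn), ← hsign]
    push_cast
    ring
  · have h := sum_inv_choose_mul_secondOrderEulerian_eq_bernoulli hn le_rfl
    have hsign : ∀ k ∈ Finset.Icc 1 n,
        (-1 : ℚ) ^ (n - k) * ((Nat.choose (2 * n - 1) (n + k - 1) : ℚ))⁻¹ *
          (secondOrderEulerian n k : ℚ) =
        (-1) ^ n * ((-1 : ℚ) ^ k * ((Nat.choose (2 * n - 1) (n + k - 1) : ℚ))⁻¹ *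
          (secondOrderEulerian n k : ℚ)) := fun k hk => by
      have hp : (-1 : ℚ) ^ (n - k) = (-1) ^ n * (-1) ^ k := by
        rw [← pow_add, show n + k = n - k + 2 * k by have := Finset.mem_Icc.1 hk; omega, pow_add,
          pow_mul]
        simp
      rw [hp]
      ring
    rw [Finset.sum_congr rfl hsign, ← Finset.mul_sum, h, cauchySecond_eq_sum hn]
    have hs : (-1 : ℚ) ^ n * (-1) ^ (n - 1) = -1 := by
      rw [← pow_add]
      exact Odd.neg_one_pow ⟨n - 1, by omega⟩
    linear_combination (-2 * (n : ℚ) * ∑ k ∈ Finset.range n,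
      (Nat.stirlingFirst n (n - k) : ℚ) * (bernoulli (n - k) / ((n - k : ℕ) : ℚ))) * hs
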